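/- Let $\kappa\le\theta$ be cardinals and let $\lambda$ be an ordinal (for instance a cardinal). A *$\theta$-supercompactness embedding* for $\kappa$ is an elementary embedding $j\colon V\to M$ of the universe into a transitive class $M$ with critical point $\kappa$ such that $\theta<j(\kappa)$ and ${}^{\theta}M\subseteq M$. Write $H_{\theta^+}$ for the set of all $a$ whose transitive closure has cardinality at most $\theta$. A *$\theta$-supercompactness Laver function* for $\kappa$ is a function $\ell\colon\kappa\to V_\kappa$ such that for every $a\in H_{\theta^+}$ there is a $\theta$-supercompactness embedding $j$ for $\kappa$ with $j(\ell)(\kappa)=a$. A *$\theta$-supercompactness joint Laver sequence* for $\kappa$ of length $\lambda$ is a sequence $\langle \ell_\alpha:\alpha<\lambda\rangle$ of $\theta$-supercompactness Laver functions for $\kappa$ such that for every sequence $\langle a_\alpha:\alpha<\lambda\rangle$ of elements of $H_{\theta^+}$ there is a single $\theta$-supercompactness embedding $j$ for $\kappa$ with $j(\ell_\alpha)(\kappa)=a_\alpha$ for all $\alpha<\lambda$. A *normal measure* on $\mathcal{P}_\kappa(\theta)=\{x\subseteq\theta:|x|<\kappa\}$ is a $\kappa$-complete ultrafilter $U$ on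 $\mathcal{P}_\kappa(\theta)$ that is fine ($\{x:\alpha\in x\}\in U$ for all $\alpha<\theta$) and normal (every $f\colon\mathcal{P}_\kappa(\theta)\to\theta$ with $\{x:f(x)\in x\}\in U$ is constant on a set in $U$). If there is a $\theta$-supercompactness joint Laver sequence for $\kappa$ of length $\lambda$, then there are at least $2^{\theta\cdot|\lambda|}$ normal measures on $\mathcal{P}_\kappa(\theta)$ (cardinal arithmetic; for a cardinal $\lambda$ this is $2^{\theta\cdot\lambda}$). -/

import Mathlib

open Cardinal FirstOrder

universe u

namespace JointLaver

/-- Relation symbols of the language of set theory: one binary symbol. -/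
inductive SetRel : ℕ → Type
  | mem : SetRel 2

/-- The first-order language `{∈}` of set theory. -/
def setLanguage : Language := ⟨fun _ => Empty, SetRel⟩

/-- The universe of sets as an `{∈}`-structure. -/
instance universeStructure : setLanguage.Structure ZFSet.{u} where
  funMap f := Empty.elim f
  RelMap | .mem => fun v => v 0 ∈ v 1

/-- A class of sets as an `{∈}`-structure, with the true membership relation. -/
instance classStructure (M : Set ZFSet.{u}) : setLanguage.Structure M where
  funMap f := Empty.elim f
  RelMap | .mem => fun v => (v 0 : ZFSet.{u}) ∈ (v 1 : ZFSet.{u})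

/-- A `θ`-supercompactness embedding with critical point `κ`: an elementary embedding
`j : V → M` into a transitive class with critical point `κ`, `θ < j(κ)` and `^θ M ⊆ M`.
Neither `M` nor `j` is required to be definable. -/
structure SupercompactnessEmbedding (κ θ : Cardinal.{u}) where
  /-- The target model. -/
  M : Set ZFSet.{u}
  transitive : ∀ x ∈ M, ∀ y ∈ x, y ∈ M
  /-- The (fully) elementary embedding. -/
  j : ZFSet.{u} ↪ₑ[setLanguage] M
  fixes_below : ∀ α < κ.ord, (j α.toZFSet : ZFSet.{u}) = α.toZFSet
  moves_crit : (j κ.ord.toZFSet : ZFSet.{u}) ≠ κ.ord.toZFSet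
  lt_image_crit : θ.ord.toZFSet ∈ (j κ.ord.toZFSet : ZFSet.{u})
  closed : ∀ y f : ZFSet.{u}, (∀ z ∈ y, z ∈ M) → ZFSet.IsFunc θ.ord.toZFSet y f → f ∈ M

/-- `ℓ` guesses `a` via `j`, that is, `j(ℓ)(κ) = a`
(functions are sets of Kuratowski pairs). -/
def Guesses {κ θ : Cardinal.{u}} (E : SupercompactnessEmbedding κ θ) (ℓ a : ZFSet.{u}) : Prop :=
  ZFSet.pair κ.ord.toZFSet a ∈ (E.j ℓ : ZFSet.{u})

/-- `x ∈ H_μ`: the transitive closure of `x` has cardinality less than `μ`. -/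
def MemH (μ : Cardinal.{u}) (x : ZFSet.{u}) : Prop :=
  ∃ t : ZFSet.{u}, t.IsTransitive ∧ x ⊆ t ∧ t.card < μ

/-- `ℓ : κ → V_κ` is a `θ`-supercompactness Laver function for `κ`. -/
def IsLaverFunction (κ θ : Cardinal.{u}) (ℓ : ZFSet.{u}) : Prop :=
  ZFSet.IsFunc κ.ord.toZFSet (ZFSet.vonNeumann κ.ord) ℓ ∧
    ∀ a, MemH (Order.succ θ) a → ∃ E : SupercompactnessEmbedding κ θ, Guesses E ℓ a

/-- `⟨ℓ α : α < lam⟩` is a `θ`-supercompactness joint Laver sequence for `κ`. -/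
def IsJointLaverSequence (κ θ : Cardinal.{u}) (lam : Ordinal.{u})
    (ℓ : Set.Iio lam → ZFSet.{u}) : Prop :=
  (∀ α, IsLaverFunction κ θ (ℓ α)) ∧
    ∀ a : Set.Iio lam → ZFSet.{u}, (∀ α, MemH (Order.succ θ) (a α)) →
      ∃ E : SupercompactnessEmbedding κ θ, ∀ α, Guesses E (ℓ α) (a α)

/-- `P_κ(θ)`, the subsets of `θ` of size less than `κ`. -/
def PKappa (κ θ : Cardinal.{u}) : Type u :=
  {x : Set θ.ord.ToType // #x < κ}

/-- A normal measure on `P_κ(θ)`: a `κ`-complete, fine, normal ultrafilter. -/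
structure IsNormalMeasure {κ θ : Cardinal.{u}} (U : Ultrafilter (PKappa κ θ)) : Prop where
  complete : CardinalInterFilter (U : Filter (PKappa κ θ)) κ
  fine : ∀ a : θ.ord.ToType, ∀ᶠ x in (U : Filter (PKappa κ θ)), a ∈ x.1
  normal : ∀ f : PKappa κ θ → θ.ord.ToType,
    (∀ᶠ x in (U : Filter (PKappa κ θ)), f x ∈ x.1) →
      ∃ a, ∀ᶠ x in (U : Filter (PKappa κ θ)), f x = a

end JointLaver

/-! Subsets of θ lie in H_{θ⁺}, so each sequence A of subsets of θ indexed by `lam` is guessed by a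
single embedding j. The measure derived from j with seed j''θ is normal (`isNormalMeasure_measure`)
and remembers A: the order types of j''θ ∩ j(κ) and j''θ ∩ j(γ) are κ and γ, so {x : otp(x ∩ γ) ∈
ℓ_α(otp(x ∩ κ))} is in the measure iff γ ∈ j(ℓ_α)(κ) = A_α (`large_guessSet_iff`). Hence A ↦ measure
is injective on a set of size (2^θ)^|λ|. Elementarity enters through properties defined by one
bounded formula in all transitive classes (`transfer`); only `seed_mem` needs an unbounded
quantifier (`transfer_forall`). -/

namespace JointLaver

/-! ### Absoluteness of bounded properties -/

open FirstOrder.Language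

/-- An isomorphism of an `{∈}`-structure onto a transitive class, as a map into the universe. -/
structure IsTransitiveEmbedding {A : Type*} [setLanguage.Structure A] (i : A → ZFSet.{u}) :
    Prop where
  injective : Function.Injective i
  relMap_mem : ∀ v : Fin 2 → A, Structure.RelMap (L := setLanguage) SetRel.mem v ↔ i (v 0) ∈ i (v 1)
  transitive : ∀ a, ∀ y ∈ i a, ∃ b, i b = y

theorem isTransitiveEmbedding_id : IsTransitiveEmbedding (id : ZFSet.{u} → ZFSet.{u}) where
  injective := Function.injective_id
  relMap_mem _ := Iff.rfl
  transitive _ y _ := ⟨y, rfl⟩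

theorem isTransitiveEmbedding_val {M : Set ZFSet.{u}} (hM : ∀ x ∈ M, ∀ y ∈ x, y ∈ M) :
    IsTransitiveEmbedding (Subtype.val : M → ZFSet.{u}) where
  injective := Subtype.val_injective
  relMap_mem _ := Iff.rfl
  transitive a y hy := ⟨⟨y, hM a a.2 y hy⟩, rfl⟩

/-- A predicate on assignments of sets is absolute if one formula defines it
in every transitive class. -/
def IsAbsolute {α : Type} (P : (α → ZFSet.{u}) → Prop) : Prop :=
  ∃ φ : setLanguage.Formula α, ∀ (A : Type (u + 1)) [setLanguage.Structure A] (i : A → ZFSet.{u}),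
    IsTransitiveEmbedding i → ∀ v : α → A, φ.Realize v ↔ P fun a => i (v a)

namespace IsAbsolute

variable {α : Type} {P Q : (α → ZFSet.{u}) → Prop}

theorem mem (a b : α) : IsAbsolute fun v : α → ZFSet.{u} => v a ∈ v b :=
  ⟨Relations.formula₂ (L := setLanguage) SetRel.mem (Term.var a) (Term.var b),
    fun _ _ _ hi _ => Formula.realize_rel₂.trans (hi.relMap_mem _)⟩

theorem eq (a b : α) : IsAbsolute fun v : α → ZFSet.{u} => v a = v b :=
  ⟨Term.equal (L := setLanguage) (Term.var a) (Term.var b),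
    fun A _ i hi v => by rw [Formula.realize_equal]; exact hi.injective.eq_iff.symm⟩

theorem not (hP : IsAbsolute P) : IsAbsolute fun v => ¬ P v := by
  obtain ⟨φ, hφ⟩ := hP
  exact ⟨φ.not, fun A _ i hi v => by rw [Formula.realize_not, hφ A i hi]⟩

theorem and (hP : IsAbsolute P) (hQ : IsAbsolute Q) : IsAbsolute fun v => P v ∧ Q v := by
  obtain ⟨φ, hφ⟩ := hP
  obtain ⟨ψ, hψ⟩ := hQ
  exact ⟨φ ⊓ ψ, fun A _ i hi v => by rw [Formula.realize_inf, hφ A i hi, hψ A i hi]⟩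

theorem imp (hP : IsAbsolute P) (hQ : IsAbsolute Q) : IsAbsolute fun v => P v → Q v := by
  obtain ⟨φ, hφ⟩ := hP
  obtain ⟨ψ, hψ⟩ := hQ
  exact ⟨φ.imp ψ, fun A _ i hi v => by rw [Formula.realize_imp, hφ A i hi, hψ A i hi]⟩

theorem congr (hP : IsAbsolute P) (h : ∀ v, P v ↔ Q v) : IsAbsolute Q := by
  rwa [← show P = Q from funext fun v => propext (h v)]

theorem or (hP : IsAbsolute P) (hQ : IsAbsolute Q) : IsAbsolute fun v => P v ∨ Q v :=
  (hP.not.imp hQ).congr fun _ => or_iff_not_imp_left.symm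

theorem iff (hP : IsAbsolute P) (hQ : IsAbsolute Q) : IsAbsolute fun v => (P v ↔ Q v) :=
  ((hP.imp hQ).and (hQ.imp hP)).congr fun _ => iff_iff_implies_and_implies.symm

/-- Transitivity puts every witness inside the class, so a bounded quantifier has the same meaning
there as in V. -/
theorem bex {R : (α → ZFSet.{u}) → ZFSet.{u} → Prop} (b : α)
    (hR : IsAbsolute fun w : α ⊕ Unit → ZFSet.{u} => R (fun a => w (.inl a)) (w (.inr ()))) :
    IsAbsolute fun v => ∃ z ∈ v b, R v z := by
  obtain ⟨φ, hφ⟩ := (mem (.inr ()) (.inl b)).and hR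
  refine ⟨φ.iExs Unit, fun A _ i hi v => ?_⟩
  simp only [Formula.realize_iExs, hφ A i hi, Sum.elim_inl, Sum.elim_inr]
  constructor
  · rintro ⟨f, hf⟩
    exact ⟨_, hf⟩
  · rintro ⟨z, hz, h⟩
    obtain ⟨c, rfl⟩ := hi.transitive _ _ hz
    exact ⟨fun _ => c, hz, h⟩

theorem ball {R : (α → ZFSet.{u}) → ZFSet.{u} → Prop} (b : α)
    (hR : IsAbsolute fun w : α ⊕ Unit → ZFSet.{u} => R (fun a => w (.inl a)) (w (.inr ()))) :
    IsAbsolute fun v => ∀ z ∈ v b, R v z :=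
  (bex (R := fun v z => ¬ R v z) b hR.not).not.congr fun _ => by push Not; rfl

theorem eq_pair (p a b : α) :
    IsAbsolute fun v : α → ZFSet.{u} => v p = ZFSet.pair (v a) (v b) := by
  have h : IsAbsolute fun v : α → ZFSet.{u} =>
      ∃ s ∈ v p, ∃ t ∈ v p, (v a ∈ s ∧ ∀ z ∈ s, z = v a) ∧
        (v a ∈ t ∧ v b ∈ t ∧ ∀ z ∈ t, z = v a ∨ z = v b) ∧ ∀ z ∈ v p, z = s ∨ z = t := by
    repeat' first | exact mem _ _ | exact eq _ _ | apply bex | apply ball | apply and | apply or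
  refine h.congr fun v => ⟨?_, fun h => ?_⟩
  · rintro ⟨s, hs, t, ht, ⟨h1, h2⟩, ⟨h3, h4, h5⟩, h6⟩
    have hs' : s = {v a} := by
      ext z
      rw [ZFSet.mem_singleton]
      exact ⟨h2 z, fun h => h ▸ h1⟩
    have ht' : t = {v a, v b} := by
      ext z
      rw [ZFSet.mem_pair]
      exact ⟨h5 z, by rintro (h | h) <;> rw [h] <;> assumption⟩
    ext z
    rw [ZFSet.pair, ZFSet.mem_pair, ← hs', ← ht']
    exact ⟨h6 z, by rintro (h | h) <;> rw [h] <;> assumption⟩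
  · refine ⟨{v a}, ?_, {v a, v b}, ?_, ?_⟩ <;> simp [h, ZFSet.pair]

theorem pair_mem (a b c : α) :
    IsAbsolute fun v : α → ZFSet.{u} => ZFSet.pair (v a) (v b) ∈ v c := by
  have h : IsAbsolute fun v : α → ZFSet.{u} => ∃ p ∈ v c, p = ZFSet.pair (v a) (v b) :=
    bex _ (eq_pair _ _ _)
  exact h.congr fun v => exists_eq_right

/-- The inner pair is reached by descending through the Kuratowski coding, which keeps all
quantifiers bounded. -/
theorem triple_mem (a b c d : α) :
    IsAbsolute fun v : α → ZFSet.{u} =>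
      ZFSet.pair (v a) (ZFSet.pair (v b) (v c)) ∈ v d := by
  have h : IsAbsolute fun v : α → ZFSet.{u} =>
      ∃ p ∈ v d, ∃ t ∈ p, ∃ q ∈ t, q = ZFSet.pair (v b) (v c) ∧ p = ZFSet.pair (v a) q :=
    bex _ (bex _ (bex _ ((eq_pair _ _ _).and (eq_pair _ _ _))))
  refine h.congr fun v => ⟨?_, fun h => ?_⟩
  · rintro ⟨p, hp, t, -, q, -, rfl, rfl⟩
    exact hp
  · refine ⟨_, h, {v a, ZFSet.pair (v b) (v c)}, ?_, ZFSet.pair (v b) (v c), ?_, rfl, rfl⟩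
    · rw [ZFSet.pair, ZFSet.mem_pair]; exact .inr rfl
    · rw [ZFSet.mem_pair]; exact .inr rfl

end IsAbsolute

namespace SupercompactnessEmbedding

variable {κ θ : Cardinal.{u}} (E : SupercompactnessEmbedding κ θ) {α : Type}

theorem transfer {P : (α → ZFSet.{u}) → Prop} (hP : IsAbsolute P) (v : α → ZFSet.{u}) :
    (P fun a => E.j (v a)) ↔ P v := by
  obtain ⟨φ, hφ⟩ := hP
  rw [← hφ _ _ (isTransitiveEmbedding_val E.transitive) fun a => E.j (v a)]
  exact (E.j.map_formula φ v).trans (hφ _ _ isTransitiveEmbedding_id v)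

/-- This allows instances at elements of M outside the range of j, such as j ↾ θ. -/
theorem transfer_forall {P : (α → ZFSet.{u}) → ZFSet.{u} → Prop}
    (hP : IsAbsolute fun w : α ⊕ Unit → ZFSet.{u} => P (fun a => w (.inl a)) (w (.inr ())))
    (v : α → ZFSet.{u}) (h : ∀ z, P v z) : ∀ z ∈ E.M, P (fun a => E.j (v a)) z := by
  obtain ⟨φ, hφ⟩ := hP
  have hV : (φ.iAlls Unit).Realize v := by
    rw [Formula.realize_iAlls]
    intro f
    rw [hφ _ _ isTransitiveEmbedding_id]
    exact h _
  rw [← E.j.map_formula, Formula.realize_iAlls] at hV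
  intro z hz
  have := hV fun _ => ⟨z, hz⟩
  rwa [hφ _ _ (isTransitiveEmbedding_val E.transitive)] at this

theorem image_mem_image_iff {a b : ZFSet.{u}} : (E.j a : ZFSet.{u}) ∈ (E.j b : ZFSet.{u}) ↔ a ∈ b :=
  E.transfer (IsAbsolute.mem (0 : Fin 2) 1) ![a, b]

end SupercompactnessEmbedding

/-! ### Coding P_κ(θ) by sets -/

/-- The von Neumann ordinal named by an element of `o.ToType`. -/
noncomputable def ordinalSet {o : Ordinal.{u}} (a : o.ToType) : ZFSet.{u} :=
  (a.toOrd : Ordinal.{u}).toZFSet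

theorem ordinalSet_injective {o : Ordinal.{u}} : Function.Injective (ordinalSet (o := o)) :=
  fun _ _ h => Ordinal.ToType.mk.symm.injective (Subtype.ext (Ordinal.toZFSet_injective h))

theorem mem_toZFSet_iff_exists_ordinalSet {o : Ordinal.{u}} {z : ZFSet.{u}} :
    z ∈ o.toZFSet ↔ ∃ a : o.ToType, ordinalSet a = z := by
  rw [Ordinal.mem_toZFSet_iff]
  constructor
  · rintro ⟨a, ha, rfl⟩
    exact ⟨Ordinal.ToType.mk ⟨a, ha⟩, by simp [ordinalSet]⟩
  · rintro ⟨a, rfl⟩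
    exact ⟨_, a.toOrd.2, rfl⟩

theorem ordinalSet_mem {o : Ordinal.{u}} (a : o.ToType) : ordinalSet a ∈ o.toZFSet :=
  mem_toZFSet_iff_exists_ordinalSet.2 ⟨a, rfl⟩

/-- The set of von Neumann ordinals named by a subset of `o.ToType`. -/
noncomputable def toZFSubset {o : Ordinal.{u}} (x : Set o.ToType) : ZFSet.{u} :=
  ZFSet.range fun a : x => ordinalSet a.1

@[simp]
theorem ordinalSet_mem_toZFSubset {o : Ordinal.{u}} {x : Set o.ToType} {a : o.ToType} :
    ordinalSet a ∈ toZFSubset x ↔ a ∈ x := by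
  simp [toZFSubset, ordinalSet_injective.eq_iff]

theorem toZFSubset_subset {o : Ordinal.{u}} (x : Set o.ToType) : toZFSubset x ⊆ o.toZFSet := by
  intro z hz
  obtain ⟨a, rfl⟩ := ZFSet.mem_range.1 hz
  exact ordinalSet_mem _

theorem mem_toZFSubset {o : Ordinal.{u}} {x : Set o.ToType} {z : ZFSet.{u}} :
    z ∈ toZFSubset x ↔ ∃ a ∈ x, ordinalSet a = z := by
  simp [toZFSubset]

theorem toZFSubset_injective {o : Ordinal.{u}} : Function.Injective (toZFSubset (o := o)) := by
  intro x y h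
  ext a
  rw [← ordinalSet_mem_toZFSubset, h, ordinalSet_mem_toZFSubset]

variable {κ θ : Cardinal.{u}}

/-- The set of sets named by a subset of `P_κ(θ)`. -/
noncomputable def toZFFamily (X : Set (PKappa κ θ)) : ZFSet.{u} :=
  ZFSet.range fun x : X => toZFSubset x.1.1

theorem mem_toZFFamily {X : Set (PKappa κ θ)} {z : ZFSet.{u}} :
    z ∈ toZFFamily X ↔ ∃ x ∈ X, toZFSubset x.1 = z := by
  simp [toZFFamily]

@[simp]
theorem toZFSubset_mem_toZFFamily {X : Set (PKappa κ θ)} {x : PKappa κ θ} :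
    toZFSubset x.1 ∈ toZFFamily X ↔ x ∈ X := by
  rw [mem_toZFFamily]
  constructor
  · rintro ⟨y, hy, h⟩
    rwa [← Subtype.ext (toZFSubset_injective h)]
  · exact fun h => ⟨x, h, rfl⟩

theorem forall_mem_toZFFamily_univ {p : ZFSet.{u} → Prop} :
    (∀ z ∈ toZFFamily (Set.univ : Set (PKappa κ θ)), p z) ↔
      ∀ x : PKappa κ θ, p (toZFSubset x.1) := by
  simp [mem_toZFFamily]

/-- Choosing preimages injects the image of α under f into α, so the image has size below κ. -/
theorem exists_mem_toZFFamily_of_functional {f α : ZFSet.{u}} (hα : α ∈ κ.ord.toZFSet)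
    (hf : ∀ a ∈ α, ∀ b ∈ θ.ord.toZFSet, ∀ c ∈ θ.ord.toZFSet,
      ZFSet.pair a b ∈ f → ZFSet.pair a c ∈ f → b = c) :
    ∃ x ∈ toZFFamily (Set.univ : Set (PKappa κ θ)),
      (∀ b ∈ x, ∃ a ∈ α, ZFSet.pair a b ∈ f) ∧
        ∀ b ∈ θ.ord.toZFSet, (∃ a ∈ α, ZFSet.pair a b ∈ f) → b ∈ x := by
  obtain ⟨β, hβ, rfl⟩ := Ordinal.mem_toZFSet_iff.1 hα
  let x : Set θ.ord.ToType := {b | ∃ a ∈ β.toZFSet, ZFSet.pair a (ordinalSet b) ∈ f}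
  have hx (b : x) : ∃ a : β.ToType, ZFSet.pair (ordinalSet a) (ordinalSet b.1) ∈ f := by
    obtain ⟨a, ha, h⟩ := b.2
    obtain ⟨a, rfl⟩ := mem_toZFSet_iff_exists_ordinalSet.1 ha
    exact ⟨a, h⟩
  choose g hg using hx
  have hg_inj : Function.Injective g := fun b c h =>
    Subtype.ext <| ordinalSet_injective <| hf _ (ordinalSet_mem (g b)) _ (ordinalSet_mem _) _
      (ordinalSet_mem _) (hg b) (h ▸ hg c)
  have hcard : #x < κ := (mk_le_of_injective hg_inj).trans_lt <| by
    rw [mk_toType]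
    exact lt_ord.1 hβ
  refine ⟨toZFSubset x, mem_toZFFamily.2 ⟨⟨x, hcard⟩, trivial, rfl⟩, ?_, ?_⟩
  · intro b hb
    obtain ⟨c, hc, rfl⟩ := mem_toZFSubset.1 hb
    exact hc
  · intro b hb h
    obtain ⟨b, rfl⟩ := mem_toZFSet_iff_exists_ordinalSet.1 hb
    exact ordinalSet_mem_toZFSubset.2 h

/-! ### The normal measure derived from j''θ -/

namespace SupercompactnessEmbedding

variable (E : SupercompactnessEmbedding κ θ)

/-- The pointwise image `j''θ`. -/
noncomputable def seed : ZFSet.{u} :=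
  ZFSet.range fun a : θ.ord.ToType => (E.j (ordinalSet a) : ZFSet.{u})

theorem mem_seed {z : ZFSet.{u}} : z ∈ E.seed ↔ ∃ a : θ.ord.ToType, E.j (ordinalSet a) = z := by
  simp only [seed, ZFSet.mem_range]

/-- The restriction of `j` to `θ`. -/
noncomputable def restriction : ZFSet.{u} :=
  ZFSet.range fun a : θ.ord.ToType => ZFSet.pair (ordinalSet a) (E.j (ordinalSet a))

theorem pair_mem_restriction {z w : ZFSet.{u}} :
    ZFSet.pair z w ∈ E.restriction ↔
      ∃ a : θ.ord.ToType, ordinalSet a = z ∧ E.j (ordinalSet a) = w := by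
  simp only [restriction, ZFSet.mem_range, ZFSet.pair_inj]

theorem restriction_mem_M : E.restriction ∈ E.M := by
  refine E.closed E.seed _ (fun z hz => ?_) ⟨fun p hp => ?_, fun z hz => ?_⟩
  · obtain ⟨a, rfl⟩ := E.mem_seed.1 hz
    exact (E.j _).2
  · obtain ⟨a, rfl⟩ := ZFSet.mem_range.1 hp
    exact ZFSet.pair_mem_prod.2 ⟨ordinalSet_mem a, E.mem_seed.2 ⟨a, rfl⟩⟩
  · obtain ⟨a, rfl⟩ := mem_toZFSet_iff_exists_ordinalSet.1 hz
    refine ⟨E.j (ordinalSet a), E.pair_mem_restriction.2 ⟨a, rfl, rfl⟩, fun w hw => ?_⟩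
    obtain ⟨b, hb, rfl⟩ := E.pair_mem_restriction.1 hw
    rw [hb]

/-- By elementarity, M believes that images of ordinals below j(κ) under functions into j(θ) lie in
j(P_κ(θ)). Apply this to j ↾ θ ∈ M, whose domain θ is below j(κ). -/
theorem seed_mem : E.seed ∈ (E.j (toZFFamily (Set.univ : Set (PKappa κ θ))) : ZFSet.{u}) := by
  have key := E.transfer_forall (α := Fin 3)
    (P := fun v f => ∀ α ∈ v 0,
      (∀ a ∈ α, ∀ b ∈ v 1, ∀ c ∈ v 1, ZFSet.pair a b ∈ f → ZFSet.pair a c ∈ f → b = c) →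
      ∃ x ∈ v 2, (∀ b ∈ x, ∃ a ∈ α, ZFSet.pair a b ∈ f) ∧
        ∀ b ∈ v 1, (∃ a ∈ α, ZFSet.pair a b ∈ f) → b ∈ x)
    (by
      repeat' first
        | exact IsAbsolute.mem _ _ | exact IsAbsolute.eq _ _ | exact IsAbsolute.pair_mem _ _ _
        | apply IsAbsolute.bex | apply IsAbsolute.ball | apply IsAbsolute.and
        | apply IsAbsolute.imp)
    ![κ.ord.toZFSet, θ.ord.toZFSet, toZFFamily (Set.univ : Set (PKappa κ θ))]
    (fun f α hα hf => exists_mem_toZFFamily_of_functional hα hf)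
    E.restriction E.restriction_mem_M θ.ord.toZFSet E.lt_image_crit
  obtain ⟨x, hx, h1, h2⟩ := key fun a _ b _ c _ hb hc => by
    obtain ⟨d, hd, rfl⟩ := E.pair_mem_restriction.1 hb
    obtain ⟨e, he, rfl⟩ := E.pair_mem_restriction.1 hc
    rw [hd, he]
  suffices E.seed = x from this ▸ hx
  ext z
  constructor
  · intro hz
    obtain ⟨a, rfl⟩ := E.mem_seed.1 hz
    exact h2 _ (E.image_mem_image_iff.2 (ordinalSet_mem a))
      ⟨_, ordinalSet_mem a, E.pair_mem_restriction.2 ⟨a, rfl, rfl⟩⟩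
  · intro hz
    obtain ⟨a, -, h⟩ := h1 z hz
    obtain ⟨b, -, rfl⟩ := E.pair_mem_restriction.1 h
    exact E.mem_seed.2 ⟨b, rfl⟩

/-- The sets whose image under `j` contains the seed `j''θ`. -/
def Large (X : Set (PKappa κ θ)) : Prop :=
  E.seed ∈ (E.j (toZFFamily X) : ZFSet.{u})

theorem large_univ : E.Large Set.univ := E.seed_mem

variable {E} in
theorem Large.mono {X Y : Set (PKappa κ θ)} (hX : E.Large X) (h : X ⊆ Y) : E.Large Y :=
  (E.transfer (P := fun v : Fin 2 → ZFSet.{u} => ∀ x ∈ v 0, x ∈ v 1)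
    (.ball _ (.mem _ _)) ![toZFFamily X, toZFFamily Y]).2
    (fun z hz => by
      obtain ⟨x, hx, rfl⟩ := mem_toZFFamily.1 hz
      exact toZFSubset_mem_toZFFamily.2 (h hx)) _ hX

theorem large_compl {X : Set (PKappa κ θ)} : E.Large Xᶜ ↔ ¬ E.Large X :=
  (E.transfer (P := fun v : Fin 3 → ZFSet.{u} => ∀ x ∈ v 0, (x ∈ v 1 ↔ ¬ x ∈ v 2))
    (.ball _ (.iff (.mem _ _) (.not (.mem _ _))))
    ![toZFFamily (Set.univ : Set (PKappa κ θ)), toZFFamily Xᶜ, toZFFamily X]).2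
    (forall_mem_toZFFamily_univ.2 fun x => by simp) _ E.seed_mem

variable {E} in
theorem Large.inter {X Y : Set (PKappa κ θ)} (hX : E.Large X) (hY : E.Large Y) :
    E.Large (X ∩ Y) :=
  (E.transfer (P := fun v : Fin 3 → ZFSet.{u} => ∀ x ∈ v 0, x ∈ v 1 → x ∈ v 2)
    (.ball _ (.imp (.mem _ _) (.mem _ _))) ![toZFFamily X, toZFFamily Y, toZFFamily (X ∩ Y)]).2
    (fun z hz hz' => by
      obtain ⟨x, hx, rfl⟩ := mem_toZFFamily.1 hz
      exact toZFSubset_mem_toZFFamily.2 ⟨hx, toZFSubset_mem_toZFFamily.1 hz'⟩) _ hX hY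

/-- The measure on `P_κ(θ)` derived from `j` with seed `j''θ`. -/
def measure : Ultrafilter (PKappa κ θ) :=
  Ultrafilter.ofComplNotMemIff
    { sets := {X | E.Large X}
      univ_sets := E.large_univ
      sets_of_superset := Large.mono
      inter_sets := Large.inter }
    fun _ => (not_congr E.large_compl).trans not_not

theorem mem_measure {X : Set (PKappa κ θ)} : X ∈ (E.measure : Filter (PKappa κ θ)) ↔ E.Large X :=
  Iff.rfl

theorem large_iInter {β : Ordinal.{u}} (hβ : β < κ.ord) (X : β.ToType → Set (PKappa κ θ))
    (hX : ∀ a, E.Large (X a)) : E.Large (⋂ a, X a) := by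
  -- `R` codes the whole family as one set, to which j can be applied.
  let R : ZFSet.{u} := ZFSet.range fun p : Σ a : β.ToType, X a =>
    ZFSet.pair (ordinalSet p.1) (toZFSubset p.2.1.1)
  have hR (a : β.ToType) (x : PKappa κ θ) :
      ZFSet.pair (ordinalSet a) (toZFSubset x.1) ∈ R ↔ x ∈ X a := by
    simp only [R, ZFSet.mem_range, ZFSet.pair_inj]
    constructor
    · rintro ⟨⟨b, y, hy⟩, h1, h2⟩
      obtain rfl := ordinalSet_injective h1
      rwa [← Subtype.ext (toZFSubset_injective h2)]
    · exact fun h => ⟨⟨a, x, h⟩, rfl, rfl⟩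
  have h1 := (E.transfer
    (P := fun v : Fin 4 → ZFSet.{u} => ∀ x ∈ v 0, (∀ a ∈ v 1, ZFSet.pair a x ∈ v 2) → x ∈ v 3)
    (.ball _ (.imp (.ball _ (.pair_mem _ _ _)) (.mem _ _)))
    ![toZFFamily (Set.univ : Set (PKappa κ θ)), β.toZFSet, R, toZFFamily (⋂ a, X a)]).2
    (forall_mem_toZFFamily_univ.2 fun x hx => toZFSubset_mem_toZFFamily.2 <|
      Set.mem_iInter.2 fun a => (hR a x).1 (hx _ (ordinalSet_mem a)))
  refine h1 _ E.seed_mem fun z hz => ?_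
  -- Since j(β) = β, the image family has no new indices.
  have hz' : z ∈ β.toZFSet := E.fixes_below β hβ ▸ hz
  obtain ⟨a, rfl⟩ := mem_toZFSet_iff_exists_ordinalSet.1 hz'
  have h2 := (E.transfer
    (P := fun v : Fin 3 → ZFSet.{u} => ∀ x ∈ v 0, ZFSet.pair (v 1) x ∈ v 2)
    (.ball _ (.pair_mem _ _ _)) ![toZFFamily (X a), ordinalSet a, R]).2
    (fun z hz => by
      obtain ⟨x, hx, rfl⟩ := mem_toZFFamily.1 hz
      exact (hR a x).2 hx) _ (hX a)
  have h3 : (E.j (ordinalSet a) : ZFSet.{u}) = ordinalSet a :=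
    E.fixes_below _ (lt_trans a.toOrd.2 hβ)
  rw [← h3]
  exact h2

theorem large_fine (a : θ.ord.ToType) : E.Large {x | a ∈ x.1} :=
  (E.transfer (P := fun v : Fin 3 → ZFSet.{u} => ∀ x ∈ v 0, v 1 ∈ x → x ∈ v 2)
    (.ball _ (.imp (.mem _ _) (.mem _ _)))
    ![toZFFamily (Set.univ : Set (PKappa κ θ)), ordinalSet a, toZFFamily {x | a ∈ x.1}]).2
    (forall_mem_toZFFamily_univ.2 fun _ hx =>
      toZFSubset_mem_toZFFamily.2 (ordinalSet_mem_toZFSubset.1 hx))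
    _ E.seed_mem (E.mem_seed.2 ⟨a, rfl⟩)

/-- The value of j(f) at the seed belongs to j''θ, hence is j(a) for some a < θ; this a is the
constant value. -/
theorem large_normal (f : PKappa κ θ → θ.ord.ToType) (hf : E.Large {x | f x ∈ x.1}) :
    ∃ a, E.Large {x | f x = a} := by
  let F : ZFSet.{u} := ZFSet.range fun x => ZFSet.pair (toZFSubset x.1) (ordinalSet (f x))
  have hF (x : PKappa κ θ) (a : θ.ord.ToType) :
      ZFSet.pair (toZFSubset x.1) (ordinalSet a) ∈ F ↔ f x = a := by
    simp only [F, ZFSet.mem_range, ZFSet.pair_inj]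
    constructor
    · rintro ⟨y, h1, h2⟩
      obtain rfl : y = x := Subtype.ext (toZFSubset_injective h1)
      exact ordinalSet_injective h2
    · rintro rfl
      exact ⟨x, rfl, rfl⟩
  obtain ⟨z, hz, h⟩ := (E.transfer
    (P := fun v : Fin 2 → ZFSet.{u} => ∀ x ∈ v 0, ∃ a ∈ x, ZFSet.pair x a ∈ v 1)
    (.ball _ (.bex _ (.pair_mem _ _ _))) ![toZFFamily {x | f x ∈ x.1}, F]).2
    (fun z hz => by
      obtain ⟨x, hx, rfl⟩ := mem_toZFFamily.1 hz
      exact ⟨_, ordinalSet_mem_toZFSubset.2 hx, (hF x _).2 rfl⟩) _ hf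
  obtain ⟨a, rfl⟩ := E.mem_seed.1 hz
  exact ⟨a, (E.transfer
    (P := fun v : Fin 4 → ZFSet.{u} => ∀ x ∈ v 0, ZFSet.pair x (v 1) ∈ v 2 → x ∈ v 3)
    (.ball _ (.imp (.pair_mem _ _ _) (.mem _ _)))
    ![toZFFamily (Set.univ : Set (PKappa κ θ)), ordinalSet a, F, toZFFamily {x | f x = a}]).2
    (forall_mem_toZFFamily_univ.2 fun x hx =>
      toZFSubset_mem_toZFFamily.2 ((hF x a).1 hx)) _ E.seed_mem h⟩

theorem isNormalMeasure_measure : IsNormalMeasure E.measure where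
  complete := ⟨fun S hS h => by
    obtain ⟨e⟩ : Nonempty ((#S).ord.ToType ≃ S) := Cardinal.eq.1 (by simp)
    have : ⋂₀ S = ⋂ a, (e a : Set (PKappa κ θ)) := by
      rw [Set.sInter_eq_iInter]
      exact (e.iInf_comp (g := fun s : S => (s : Set (PKappa κ θ)))).symm
    rw [this]
    exact E.large_iInter (ord_lt_ord.2 hS) _ fun a => h _ (e a).2⟩
  fine := E.large_fine
  normal := E.large_normal

end SupercompactnessEmbedding

/-! ### Order types of initial parts of j''θ -/

/-- The Mostowski collapse of the elements of `x`, evaluated at `γ`. For a set of ordinals `x`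
and an ordinal `γ`, this is the order type of `x ∩ γ`. -/
noncomputable def collapse (x γ : ZFSet.{u}) : ZFSet.{u} :=
  ZFSet.range fun d : (x ∩ γ : ZFSet.{u}) => collapse x d.1
termination_by γ
decreasing_by exact (ZFSet.mem_inter.1 d.2).2

theorem mem_collapse {x γ z : ZFSet.{u}} :
    z ∈ collapse x γ ↔ ∃ δ ∈ x, δ ∈ γ ∧ collapse x δ = z := by
  rw [collapse, ZFSet.mem_range]
  constructor
  · rintro ⟨d, h⟩
    exact ⟨d, (ZFSet.mem_inter.1 d.2).1, (ZFSet.mem_inter.1 d.2).2, h⟩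
  · rintro ⟨δ, h1, h2, h⟩
    exact ⟨⟨δ, ZFSet.mem_inter.2 ⟨h1, h2⟩⟩, h⟩

/-- The set of values of `collapse x γ` for `x ∈ p` and `γ ∈ d`. -/
noncomputable def collapseRange (p d : ZFSet.{u}) : ZFSet.{u} :=
  ZFSet.range fun q : p × d => collapse q.1 q.2

/-- The set of triples `(γ, x, collapse x γ)` for `x ∈ p` and `γ ∈ d`. -/
noncomputable def collapseGraph (p d : ZFSet.{u}) : ZFSet.{u} :=
  ZFSet.range fun q : p × d => ZFSet.pair q.2 (ZFSet.pair q.1 (collapse q.1 q.2))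

theorem collapse_mem_collapseRange {p d x γ : ZFSet.{u}} (hx : x ∈ p) (hγ : γ ∈ d) :
    collapse x γ ∈ collapseRange p d :=
  ZFSet.mem_range.2 ⟨(⟨x, hx⟩, ⟨γ, hγ⟩), rfl⟩

theorem triple_mem_collapseGraph {p d x γ h : ZFSet.{u}} :
    ZFSet.pair γ (ZFSet.pair x h) ∈ collapseGraph p d ↔ x ∈ p ∧ γ ∈ d ∧ h = collapse x γ := by
  simp only [collapseGraph, ZFSet.mem_range, ZFSet.pair_inj]
  constructor
  · rintro ⟨⟨x, γ⟩, rfl, rfl, rfl⟩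
    exact ⟨x.2, γ.2, rfl⟩
  · rintro ⟨hx, hγ, rfl⟩
    exact ⟨(⟨x, hx⟩, ⟨γ, hγ⟩), rfl, rfl, rfl⟩

variable (κ θ) in
/-- `P_κ(θ)` as a set. -/
noncomputable abbrev pKappaSet : ZFSet.{u} := toZFFamily (Set.univ : Set (PKappa κ θ))

variable (θ) in
/-- The set of ordinals up to and including `θ`. -/
noncomputable abbrev succSet : ZFSet.{u} := (Order.succ θ.ord).toZFSet

theorem mem_succSet_of_mem {γ δ : ZFSet.{u}} (hγ : γ ∈ succSet θ) (hδ : δ ∈ γ) : δ ∈ succSet θ :=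
  (ZFSet.isOrdinal_toZFSet _).mem_trans hδ hγ

namespace SupercompactnessEmbedding

variable (E : SupercompactnessEmbedding κ θ)

theorem exists_triple_mem_image_collapseGraph {γ : ZFSet.{u}} (hγ : γ ∈ succSet θ) :
    ∃ h ∈ (E.j (collapseRange (pKappaSet κ θ) (succSet θ)) : ZFSet.{u}),
      ZFSet.pair (E.j γ) (ZFSet.pair E.seed h) ∈
        (E.j (collapseGraph (pKappaSet κ θ) (succSet θ)) : ZFSet.{u}) :=
  (E.transfer (P := fun v : Fin 4 → ZFSet.{u} =>
      ∀ x ∈ v 0, ∃ h ∈ v 1, ZFSet.pair (v 2) (ZFSet.pair x h) ∈ v 3)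
    (.ball _ (.bex _ (.triple_mem _ _ _ _)))
    ![pKappaSet κ θ, collapseRange (pKappaSet κ θ) (succSet θ), γ,
      collapseGraph (pKappaSet κ θ) (succSet θ)]).2
    (fun _ hx => ⟨_, collapse_mem_collapseRange hx hγ, triple_mem_collapseGraph.2 ⟨hx, hγ, rfl⟩⟩)
    _ E.seed_mem

/-- In the target model, the collapse of `j''θ` sends `j γ` back to `γ`. -/
theorem eq_of_triple_mem_image_collapseGraph (γ : Ordinal.{u}) (hγ : γ ≤ θ.ord)
    {h : ZFSet.{u}} (hh : h ∈ (E.j (collapseRange (pKappaSet κ θ) (succSet θ)) : ZFSet.{u}))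
    (hp : ZFSet.pair (E.j γ.toZFSet) (ZFSet.pair E.seed h) ∈
      (E.j (collapseGraph (pKappaSet κ θ) (succSet θ)) : ZFSet.{u})) :
    h = γ.toZFSet := by
  induction γ using WellFoundedLT.induction generalizing h with
  | ind γ ih =>
  have hγ' : γ.toZFSet ∈ succSet θ :=
    Ordinal.toZFSet_mem_toZFSet_iff.2 (Order.lt_succ_iff.2 hγ)
  let v : Fin 4 → ZFSet.{u} := ![pKappaSet κ θ, collapseRange (pKappaSet κ θ) (succSet θ),
    γ.toZFSet, collapseGraph (pKappaSet κ θ) (succSet θ)]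
  -- `h1` and `h2` are the two halves of the recursion for the collapse, read at the seed. With its
  -- graph and range as parameters they are bounded, so the recursion itself need not be shown
  -- absolute.
  have h1 := (E.transfer (P := fun v : Fin 4 → ZFSet.{u} =>
      ∀ x ∈ v 0, ∀ h ∈ v 1, ZFSet.pair (v 2) (ZFSet.pair x h) ∈ v 3 →
        ∀ z ∈ h, z ∈ v 1 ∧ ∃ δ ∈ x, δ ∈ v 2 ∧ ZFSet.pair δ (ZFSet.pair x z) ∈ v 3)
    (.ball _ (.ball _ (.imp (.triple_mem _ _ _ _) (.ball _ (.and (.mem _ _)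
      (.bex _ (.and (.mem _ _) (.triple_mem _ _ _ _)))))))) v).2
    (by
      intro x hx h _ hp z hz
      obtain ⟨-, -, rfl⟩ := triple_mem_collapseGraph.1 hp
      obtain ⟨δ, hδx, hδ, rfl⟩ := mem_collapse.1 hz
      have hδ' := mem_succSet_of_mem hγ' hδ
      exact ⟨collapse_mem_collapseRange hx hδ', δ, hδx, hδ,
        triple_mem_collapseGraph.2 ⟨hx, hδ', rfl⟩⟩) _ E.seed_mem _ hh hp
  have h2 := (E.transfer (P := fun v : Fin 4 → ZFSet.{u} =>
      ∀ x ∈ v 0, ∀ h ∈ v 1, ZFSet.pair (v 2) (ZFSet.pair x h) ∈ v 3 →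
        ∀ δ ∈ x, δ ∈ v 2 → ∃ z ∈ h, z ∈ v 1 ∧ ZFSet.pair δ (ZFSet.pair x z) ∈ v 3)
    (.ball _ (.ball _ (.imp (.triple_mem _ _ _ _) (.ball _ (.imp (.mem _ _)
      (.bex _ (.and (.mem _ _) (.triple_mem _ _ _ _)))))))) v).2
    (by
      intro x hx h _ hp δ hδx hδ
      obtain ⟨-, -, rfl⟩ := triple_mem_collapseGraph.1 hp
      have hδ' := mem_succSet_of_mem hγ' hδ
      exact ⟨_, mem_collapse.2 ⟨δ, hδx, hδ, rfl⟩, collapse_mem_collapseRange hx hδ',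
        triple_mem_collapseGraph.2 ⟨hx, hδ', rfl⟩⟩) _ E.seed_mem _ hh hp
  -- Elements of j''θ ∩ j(γ) are the j(δ) with δ < γ, and by induction these collapse to δ.
  ext z
  constructor
  · intro hz
    obtain ⟨hzR, δ, hδs, hδ, hδp⟩ := h1 z hz
    obtain ⟨a, rfl⟩ := E.mem_seed.1 hδs
    have ha := E.image_mem_image_iff.1 hδ
    have ha' := Ordinal.toZFSet_mem_toZFSet_iff.1 ha
    rw [ih _ ha' (ha'.le.trans hγ) hzR hδp]
    exact ha
  · intro hz
    obtain ⟨δ, hδ, rfl⟩ := Ordinal.mem_toZFSet_iff.1 hz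
    obtain ⟨a, ha⟩ := mem_toZFSet_iff_exists_ordinalSet.1
      (Ordinal.toZFSet_mem_toZFSet_iff.2 (hδ.trans_le hγ))
    obtain ⟨w, hw, hwR, hwp⟩ := h2 (E.j δ.toZFSet) (E.mem_seed.2 ⟨a, by rw [ha]⟩)
      (E.image_mem_image_iff.2 hz)
    rwa [← ih δ hδ (hδ.le.trans hγ) hwR hwp]

theorem triple_mem_image_collapseGraph {γ : Ordinal.{u}} (hγ : γ ≤ θ.ord) :
    γ.toZFSet ∈ (E.j (collapseRange (pKappaSet κ θ) (succSet θ)) : ZFSet.{u}) ∧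
      ZFSet.pair (E.j γ.toZFSet) (ZFSet.pair E.seed γ.toZFSet) ∈
        (E.j (collapseGraph (pKappaSet κ θ) (succSet θ)) : ZFSet.{u}) := by
  obtain ⟨k, hk, hp⟩ := E.exists_triple_mem_image_collapseGraph
    (Ordinal.toZFSet_mem_toZFSet_iff.2 (Order.lt_succ_iff.2 hγ))
  have := E.eq_of_triple_mem_image_collapseGraph γ hγ hk hp
  subst this
  exact ⟨hk, hp⟩

end SupercompactnessEmbedding

/-! ### Reading the guessed set off the measure -/

/-- The points `x` of `P_κ(θ)` for which `otp (x ∩ γ) ∈ ℓ (otp (x ∩ κ))`. -/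
def guessSet (κ θ : Cardinal.{u}) (ℓ : ZFSet.{u}) (γ : Ordinal.{u}) : Set (PKappa κ θ) :=
  {x | ∃ b, ZFSet.pair (collapse (toZFSubset x.1) κ.ord.toZFSet) b ∈ ℓ ∧
    collapse (toZFSubset x.1) γ.toZFSet ∈ b}

theorem SupercompactnessEmbedding.large_guessSet_iff (E : SupercompactnessEmbedding κ θ)
    (hκθ : κ ≤ θ) {ℓ a d c : ZFSet.{u}} (hℓ : ZFSet.IsFunc d c ℓ) (ha : Guesses E ℓ a)
    {γ : Ordinal.{u}} (hγ : γ ≤ θ.ord) :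
    E.Large (guessSet κ θ ℓ γ) ↔ γ.toZFSet ∈ a := by
  -- The case κ = θ is allowed, which is why collapses are tabulated up to and including θ.
  have hκ : κ.ord ≤ θ.ord := ord_le_ord.2 hκθ
  have hγD : γ.toZFSet ∈ succSet θ := Ordinal.toZFSet_mem_toZFSet_iff.2 (Order.lt_succ_iff.2 hγ)
  have hκD : κ.ord.toZFSet ∈ succSet θ :=
    Ordinal.toZFSet_mem_toZFSet_iff.2 (Order.lt_succ_iff.2 hκ)
  have hdef := (E.transfer (P := fun v : Fin 8 → ZFSet.{u} =>
      ∀ x ∈ v 0, (x ∈ v 1 ↔ ∃ k ∈ v 2, ∃ h ∈ v 2, ∃ b ∈ v 3,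
        ZFSet.pair (v 4) (ZFSet.pair x k) ∈ v 5 ∧ ZFSet.pair (v 6) (ZFSet.pair x h) ∈ v 5 ∧
          ZFSet.pair k b ∈ v 7 ∧ h ∈ b))
    (.ball _ (.iff (.mem _ _) (.bex _ (.bex _ (.bex _ (.and (.triple_mem _ _ _ _)
      (.and (.triple_mem _ _ _ _) (.and (.pair_mem _ _ _) (.mem _ _)))))))))
    ![pKappaSet κ θ, toZFFamily (guessSet κ θ ℓ γ),
      collapseRange (pKappaSet κ θ) (succSet θ), c, κ.ord.toZFSet,
      collapseGraph (pKappaSet κ θ) (succSet θ), γ.toZFSet, ℓ]).2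
    (forall_mem_toZFFamily_univ.2 fun x => by
      have hx : toZFSubset x.1 ∈ pKappaSet κ θ := toZFSubset_mem_toZFFamily.2 trivial
      refine toZFSubset_mem_toZFFamily.trans ⟨?_, ?_⟩
      · rintro ⟨b, hb, h⟩
        exact ⟨_, collapse_mem_collapseRange hx hκD, _, collapse_mem_collapseRange hx hγD, b,
          (ZFSet.pair_mem_prod.1 (hℓ.1 hb)).2, triple_mem_collapseGraph.2 ⟨hx, hκD, rfl⟩,
          triple_mem_collapseGraph.2 ⟨hx, hγD, rfl⟩, hb, h⟩
      · rintro ⟨k, -, h, -, b, -, hk, hh, hb, hhb⟩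
        obtain ⟨-, -, rfl⟩ := triple_mem_collapseGraph.1 hk
        obtain ⟨-, -, rfl⟩ := triple_mem_collapseGraph.1 hh
        exact ⟨b, hb, hhb⟩) _ E.seed_mem
  -- `hcod` places a in j(c), the bound for values in `hdef`; `hfun` makes a the only value of j(ℓ)
  -- at κ.
  have hcod := (E.transfer (P := fun v : Fin 3 → ZFSet.{u} =>
      ∀ p ∈ v 0, ∃ k ∈ v 1, ∃ b ∈ v 2, p = ZFSet.pair k b)
    (.ball _ (.bex _ (.bex _ (.eq_pair _ _ _)))) ![ℓ, d, c]).2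
    (fun p hp => ZFSet.mem_prod.1 (hℓ.1 hp)) _ ha
  have hfun := (E.transfer (P := fun v : Fin 3 → ZFSet.{u} =>
      ∀ k ∈ v 1, ∀ b ∈ v 2, ∀ b' ∈ v 2, ZFSet.pair k b ∈ v 0 → ZFSet.pair k b' ∈ v 0 → b = b')
    (.ball _ (.ball _ (.ball _ (.imp (.pair_mem _ _ _) (.imp (.pair_mem _ _ _) (.eq _ _))))))
    ![ℓ, d, c]).2
    (fun k hk b _ b' _ h h' => (hℓ.2 k hk).unique h h')
  obtain ⟨k, hk, b, hb, hp⟩ := hcod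
  obtain ⟨rfl, rfl⟩ := ZFSet.pair_inj.1 hp
  refine hdef.trans ⟨?_, fun h => ?_⟩
  · rintro ⟨k, hkR, h, hhR, b, hbc, hk', hh, hkb, hhb⟩
    obtain rfl := E.eq_of_triple_mem_image_collapseGraph _ hκ hkR hk'
    obtain rfl := E.eq_of_triple_mem_image_collapseGraph _ hγ hhR hh
    rwa [hfun _ hk _ hb _ hbc ha hkb]
  · obtain ⟨hκR, hκG⟩ := E.triple_mem_image_collapseGraph hκ
    obtain ⟨hγR, hγG⟩ := E.triple_mem_image_collapseGraph hγ
    exact ⟨_, hκR, _, hγR, _, hb, hκG, hγG, ha, h⟩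

theorem memH_toZFSubset (x : Set θ.ord.ToType) : MemH (Order.succ θ) (toZFSubset x) :=
  ⟨θ.ord.toZFSet, (ZFSet.isOrdinal_toZFSet _).isTransitive, toZFSubset_subset x, by simp⟩

end JointLaver

theorem proposition3p9 (κ θ : Cardinal.{u}) (lam : Ordinal.{u}) (hκθ : κ ≤ θ)
    (h : ∃ ℓ : Set.Iio lam → ZFSet.{u}, JointLaver.IsJointLaverSequence κ θ lam ℓ) :
    2 ^ (θ * lam.card) ≤
      #{U : Ultrafilter (JointLaver.PKappa κ θ) // JointLaver.IsNormalMeasure U} := by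
  open JointLaver in
  obtain ⟨ℓ, hℓ, hjoint⟩ := h
  have hE (A : lam.ToType → Set θ.ord.ToType) :
      ∃ E : SupercompactnessEmbedding κ θ,
        ∀ α, Guesses E (ℓ α) (toZFSubset (A (Ordinal.ToType.mk α))) :=
    hjoint _ fun _ => memH_toZFSubset _
  choose E hE using hE
  have hinj : Function.Injective fun A =>
      (⟨(E A).measure, (E A).isNormalMeasure_measure⟩ :
        {U : Ultrafilter (PKappa κ θ) // IsNormalMeasure U}) := by
    intro A B hAB
    have hU : (E A).measure = (E B).measure := congrArg Subtype.val hAB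
    funext i
    obtain ⟨α, rfl⟩ := Ordinal.ToType.mk.surjective i
    ext c
    have hc : (c.toOrd : Ordinal.{u}) ≤ θ.ord := le_of_lt c.toOrd.2
    -- Both memberships of c are decided by whether the same `guessSet` lies in the common measure.
    rw [← ordinalSet_mem_toZFSubset, ← ordinalSet_mem_toZFSubset, ordinalSet,
      ← (E A).large_guessSet_iff hκθ (hℓ α).1 (hE A α) hc,
      ← (E B).large_guessSet_iff hκθ (hℓ α).1 (hE B α) hc,
      ← (E A).mem_measure, hU, (E B).mem_measure]
  calc (2 : Cardinal.{u}) ^ (θ * lam.card) = #(lam.ToType → Set θ.ord.ToType) := by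
        simp [power_mul]
    _ ≤ _ := mk_le_of_injective hinj
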